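/- Let $r,s\ge 0$ and $n,k,\lambda\ge 1$ be integers with $\max\{r,s\}\le n\le k$, and let $\rho=(\rho_1,\dots,\rho_k)$ be a $k$-tuple of integers with $1\le\rho_\ell\le\lambda n$ for all $\ell\in[k]=\{1,\dots,k\}$ and $\sum_{\ell\in[k]}\rho_\ell=\lambda n^2$. An $r\times s$ $\lambda$-matrix on $[k]$ is an $r\times s$ array $M$ each of whose cells contains a multiset of $\lambda$ elements (symbols) of $[k]$. Write $|M_\ell|$, $|M_\ell^i|$ and $|{}^jM_\ell|$ for the number of occurrences (with multiplicity) of the symbol $\ell$ in $M$, in row $i$ of $M$, and in column $j$ of $M$; for $K\subseteq[k]$ put $|M_K^i|=\sum_{\ell\in K}|M_\ell^i|$ and $|{}^jM_K|=\sum_{\ell\in K}|{}^jM_\ell|$. An $r\times s$ $(\rho,\lambda)$-Latin rectangle is an $r\times s$ $\lambda$-matrix $M$ on $[k]$ with $|M_\ell|\le\rho_\ell$, $|M_\ell^i|\le\lambda$ and $|{}^jM_\ell|\le\lambda$ for all $\ell\in[k]$, $i\in[r]$, $j\in[s]$. An $n\times n$ $(\rho,\lambda)$-Latin square is an $n\times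 n$ $\lambda$-matrix $N$ on $[k]$ with $|N_\ell|=\rho_\ell$, $|N_\ell^i|\le\lambda$ and $|{}^jN_\ell|\le\lambda$ for all $\ell\in[k]$, $i,j\in[n]$. It extends $M$ if its top left $r\times s$ corner is $M$. For $x,y\in\mathbb{R}$ let $x\mathbin{\dot-}y=\max\{0,x-y\}$. For an $r\times s$ $(\rho,\lambda)$-Latin rectangle $M$ put $$\alpha_\ell=(\rho_\ell-|M_\ell|+\lambda r)\mathbin{\dot-}\lambda n,\qquad \beta_\ell=(\rho_\ell-|M_\ell|+\lambda s)\mathbin{\dot-}\lambda n\qquad(\ell\in[k]).$$ Call $M$ admissible if there are nonnegative integers $a_\ell,b_\ell$ ($\ell\in[k]$) such that $$\sum_{\ell\in[k]}a_\ell=\lambda r(n-s)-\sum_{\ell\in[k]}\alpha_\ell,\qquad \sum_{\ell\in[k]}b_\ell=\lambda s(n-r)-\sum_{\ell\in[k]}\beta_\ell,$$ for all $\ell\in[k]$, $$a_\ell\le\lambda r-|M_\ell|-\alpha_\ell,\qquad b_\ell\le\lambda s-|M_\ell|-\beta_\ell,\qquad a_\ell+b_\ell\le\rho_\ell-|M_\ell|-\alpha_\ell-\beta_\ell,$$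 and for all $K\subseteq[k]$, $$\sum_{i\in[r]}\Big((\lambda n-\lambda s+|M_K^i|)\mathbin{\dot-}\lambda|K|\Big)\le\sum_{\ell\in[k]\setminus K}(a_\ell+\alpha_\ell),$$ $$\sum_{j\in[s]}\Big((\lambda n-\lambda r+|{}^jM_K|)\mathbin{\dot-}\lambda|K|\Big)\le\sum_{\ell\in[k]\setminus K}(b_\ell+\beta_\ell).$$ **Theorem.** An $r\times s$ $(\rho,\lambda)$-Latin rectangle can be extended to an $n\times n$ $(\rho,\lambda)$-Latin square if and only if it is admissible. -/

import Mathlib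

namespace RhoLatin

/-- An `r × s` array whose cells are multisets of symbols from `Fin k` (the set of `k` symbols). -/
abbrev MultiArray (r s k : ℕ) : Type := Fin r → Fin s → Multiset (Fin k)

/-- An `r × s` `λ`-matrix: every cell contains exactly `lam` symbols, counted with multiplicity. -/
def IsLambdaMatrix {r s k : ℕ} (lam : ℕ) (M : MultiArray r s k) : Prop :=
  ∀ i j, Multiset.card (M i j) = lam

/-- The number of occurrences of the symbol `l` in the whole array. -/
def occ {r s k : ℕ} (M : MultiArray r s k) (l : Fin k) : ℕ :=
  ∑ i, ∑ j, (M i j).count l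

/-- The number of occurrences of the symbol `l` in row `i`. -/
def rowOcc {r s k : ℕ} (M : MultiArray r s k) (i : Fin r) (l : Fin k) : ℕ :=
  ∑ j, (M i j).count l

/-- The number of occurrences of the symbol `l` in column `j`. -/
def colOcc {r s k : ℕ} (M : MultiArray r s k) (j : Fin s) (l : Fin k) : ℕ :=
  ∑ i, (M i j).count l

/-- The number of occurrences of symbols of `K` in row `i`. -/
def rowOccSet {r s k : ℕ} (M : MultiArray r s k) (i : Fin r) (K : Finset (Fin k)) : ℕ :=
  ∑ l ∈ K, rowOcc M i l

/-- The number of occurrences of symbols of `K` in column `j`. -/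
def colOccSet {r s k : ℕ} (M : MultiArray r s k) (j : Fin s) (K : Finset (Fin k)) : ℕ :=
  ∑ l ∈ K, colOcc M j l

/-- An `r × s` `(ρ, λ)`-Latin rectangle. -/
structure IsLatinRectangle {r s k : ℕ} (rho : Fin k → ℕ) (lam : ℕ)
    (M : MultiArray r s k) : Prop where
  isLambdaMatrix : IsLambdaMatrix lam M
  occ_le : ∀ l, occ M l ≤ rho l
  rowOcc_le : ∀ i l, rowOcc M i l ≤ lam
  colOcc_le : ∀ j l, colOcc M j l ≤ lam

/-- An `n × n` `(ρ, λ)`-Latin square. -/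
structure IsLatinSquare {n k : ℕ} (rho : Fin k → ℕ) (lam : ℕ)
    (N : MultiArray n n k) : Prop where
  isLambdaMatrix : IsLambdaMatrix lam N
  occ_eq : ∀ l, occ N l = rho l
  rowOcc_le : ∀ i l, rowOcc N i l ≤ lam
  colOcc_le : ∀ j l, colOcc N j l ≤ lam

/-- The `n × n` array `N` extends the `r × s` array `M`: the top left `r × s` corner of `N`
is `M`. -/
def Extends {r s n k : ℕ} (hr : r ≤ n) (hs : s ≤ n) (N : MultiArray n n k)
    (M : MultiArray r s k) : Prop :=
  ∀ i j, N (Fin.castLE hr i) (Fin.castLE hs j) = M i j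

/-- Truncated subtraction `max {0, x - y}` (of integers). -/
def monus (x y : ℤ) : ℤ := max 0 (x - y)

/-- The conditions that a sequence of pairs `(a l, b l)` of nonnegative integers has to satisfy
in order to witness admissibility of `M`. Here `-` is subtraction of integers. -/
structure IsAdmissibleWitness {r s k : ℕ} (n : ℕ) (rho : Fin k → ℕ) (lam : ℕ)
    (M : MultiArray r s k) (a b : Fin k → ℕ) : Prop where
  sum_a : ∑ l, (a l : ℤ) =
    (lam : ℤ) * r * ((n : ℤ) - s) - ∑ l, monus ((rho l : ℤ) - occ M l + lam * r) (lam * n)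
  sum_b : ∑ l, (b l : ℤ) =
    (lam : ℤ) * s * ((n : ℤ) - r) - ∑ l, monus ((rho l : ℤ) - occ M l + lam * s) (lam * n)
  a_le : ∀ l, (a l : ℤ) ≤
    (lam : ℤ) * r - occ M l - monus ((rho l : ℤ) - occ M l + lam * r) (lam * n)
  b_le : ∀ l, (b l : ℤ) ≤
    (lam : ℤ) * s - occ M l - monus ((rho l : ℤ) - occ M l + lam * s) (lam * n)
  add_le : ∀ l, (a l : ℤ) + b l ≤
    (rho l : ℤ) - occ M l - monus ((rho l : ℤ) - occ M l + lam * r) (lam * n)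
      - monus ((rho l : ℤ) - occ M l + lam * s) (lam * n)
  row_le : ∀ K : Finset (Fin k),
    ∑ i : Fin r, monus ((lam : ℤ) * n - lam * s + rowOccSet M i K) (lam * K.card) ≤
      ∑ l ∈ Kᶜ, ((a l : ℤ) + monus ((rho l : ℤ) - occ M l + lam * r) (lam * n))
  col_le : ∀ K : Finset (Fin k),
    ∑ j : Fin s, monus ((lam : ℤ) * n - lam * r + colOccSet M j K) (lam * K.card) ≤
      ∑ l ∈ Kᶜ, ((b l : ℤ) + monus ((rho l : ℤ) - occ M l + lam * s) (lam * n))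

/-- The `r × s` `(ρ, λ)`-Latin rectangle `M` is admissible (with respect to the order `n`). -/
def IsAdmissible {r s k : ℕ} (n : ℕ) (rho : Fin k → ℕ) (lam : ℕ)
    (M : MultiArray r s k) : Prop :=
  ∃ a b : Fin k → ℕ, IsAdmissibleWitness n rho lam M a b

end RhoLatin

/-! Put p = n - r and q = n - s, and let A, B, d count a symbol in the top right, bottom left and
bottom right blocks of an extension. The symbol occurs at most pλ times in the last p rows and at
most qλ times in the last q columns; since |M_ℓ| + A + B + d = ρ_ℓ, this means A ≥ α and B ≥ β. So a
= A - α and b = B - β are the natural witnesses, and the inequalities over K are the cut conditions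
for distributing A over the first r rows and B over the first s columns.

Conversely, an amalgamated extension is built: one cell of size qλ at the end of each row, one of
size pλ below each column, and a corner of size pqλ. The outer cells come from
`exists_extend_lines`, a transportation problem solved by Hall's theorem in `exists_transport`. Then
`exists_detachment` splits the fat column into q columns and the fat row into p rows; by integrality
of transportation (`exists_split`) every bound is shared equally among the pieces. -/

/-! ### Integral transportation via Hall's theorem. -/

/-- Feasibility of a capacitated transportation problem over the natural numbers. -/
theorem exists_transport {V L : Type*} [Fintype V] [Fintype L] [DecidableEq V] [DecidableEq L]
    (R : V → ℕ) (C : L → ℕ) (c : V → L → ℕ) (htot : ∑ v, R v = ∑ l, C l)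
    (hcut : ∀ (I : Finset V) (K : Finset L),
      ∑ v ∈ I, R v ≤ ∑ l ∈ Kᶜ, C l + ∑ v ∈ I, ∑ l ∈ K, c v l) :
    ∃ x : V → L → ℕ, (∀ v l, x v l ≤ c v l) ∧ (∀ v, ∑ l, x v l = R v) ∧
      ∀ l, ∑ v, x v l = C l := by
  have hR : ∀ v, R v ≤ ∑ l, c v l := fun v => by
    simpa using hcut {v} Finset.univ
  -- Match units of capacity to slots. A unit of (v, l) is used if it takes one of the `C l` slots
  -- of l, and discarded if it takes one of the slack slots of v.
  let E := Σ e : V × L, Fin (c e.1 e.2)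
  let T := (Σ l : L, Fin (C l)) ⊕ (Σ v : V, Fin (∑ l, c v l - R v))
  let N : E → Finset T := fun e =>
    Finset.univ.filter fun t =>
      Sum.elim (fun u => decide (u.1 = e.1.2)) (fun u => decide (u.1 = e.1.1)) t = true
  have hall : ∀ S : Finset E, S.card ≤ (S.biUnion N).card := by
    intro S
    -- The neighbourhood of S depends only on its projections I and J, so Hall's condition reduces
    -- to full rectangles I × J, where it is the cut inequality for I and the complement of J.
    let I := S.image fun e => e.1.1
    let J := S.image fun e => e.1.2
    have hS : S ⊆ (I ×ˢ J).sigma fun _ => Finset.univ := by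
      intro e he
      exact Finset.mem_sigma.2 ⟨Finset.mem_product.2
        ⟨Finset.mem_image_of_mem _ he, Finset.mem_image_of_mem _ he⟩, Finset.mem_univ _⟩
    have hcS : S.card ≤ ∑ v ∈ I, ∑ l ∈ J, c v l := by
      refine (Finset.card_le_card hS).trans_eq ?_
      rw [Finset.card_sigma, Finset.sum_product]
      simp
    have hN : (J.sigma fun _ => Finset.univ).disjSum (I.sigma fun _ => Finset.univ)
        ⊆ S.biUnion N := by
      rintro (⟨l, u⟩ | ⟨v, u⟩) h
      · simp only [Finset.inl_mem_disjSum, Finset.mem_sigma, Finset.mem_univ, and_true] at h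
        obtain ⟨e, he, rfl⟩ := Finset.mem_image.1 h
        exact Finset.mem_biUnion.2 ⟨e, he, by simp [N]⟩
      · simp only [Finset.inr_mem_disjSum, Finset.mem_sigma, Finset.mem_univ, and_true] at h
        obtain ⟨e, he, rfl⟩ := Finset.mem_image.1 h
        exact Finset.mem_biUnion.2 ⟨e, he, by simp [N]⟩
    refine hcS.trans (le_trans ?_ (Finset.card_le_card hN))
    rw [Finset.card_disjSum, Finset.card_sigma, Finset.card_sigma]
    simp only [Finset.card_univ, Fintype.card_fin]
    have h1 := hcut I Jᶜ
    rw [compl_compl] at h1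
    have h2 : ∑ v ∈ I, (∑ l, c v l - R v) + ∑ v ∈ I, R v = ∑ v ∈ I, ∑ l, c v l := by
      rw [← Finset.sum_add_distrib]
      exact Finset.sum_congr rfl fun v _ => Nat.sub_add_cancel (hR v)
    have h3 : ∑ v ∈ I, ∑ l ∈ J, c v l + ∑ v ∈ I, ∑ l ∈ Jᶜ, c v l = ∑ v ∈ I, ∑ l, c v l := by
      rw [← Finset.sum_add_distrib]
      exact Finset.sum_congr rfl fun v _ => Finset.sum_add_sum_compl _ _
    omega
  obtain ⟨f, hf, hfN⟩ := (Finset.all_card_le_biUnion_card_iff_exists_injective N).1 hall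
  -- Equal cardinalities make the matching perfect, so all slots are filled and the sums are exact.
  have hcard : Fintype.card E = Fintype.card T := by
    simp only [E, T, Fintype.card_sum, Fintype.card_sigma, Fintype.card_fin, Fintype.sum_prod_type]
    have h2 : ∑ v, (∑ l, c v l - R v) + ∑ v, R v = ∑ v, ∑ l, c v l := by
      rw [← Finset.sum_add_distrib]
      exact Finset.sum_congr rfl fun v _ => Nat.sub_add_cancel (hR v)
    omega
  have hbij : Function.Bijective f := (Fintype.bijective_iff_injective_and_card f).2 ⟨hf, hcard⟩
  have hl : ∀ e u, f e = Sum.inl u → u.1 = e.1.2 := fun e u h => by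
    have := hfN e
    rw [h] at this
    simpa [N] using this
  have hv : ∀ e u, f e = Sum.inr u → u.1 = e.1.1 := fun e u h => by
    have := hfN e
    rw [h] at this
    simpa [N] using this
  let x : V → L → ℕ := fun v l => ∑ u : Fin (c v l), if (f ⟨(v, l), u⟩).isLeft then 1 else 0
  let z : V → L → ℕ := fun v l => ∑ u : Fin (c v l), if (f ⟨(v, l), u⟩).isLeft then 0 else 1
  have hxz : ∀ v l, x v l + z v l = c v l := by
    intro v l
    simp only [x, z, ← Finset.sum_add_distrib]
    rw [Finset.sum_congr rfl (g := fun _ => 1)]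
    · simp
    · intro u _
      split_ifs <;> rfl
  have hsumE : ∀ g : E → ℕ, ∑ e, g e = ∑ v, ∑ l, ∑ u : Fin (c v l), g ⟨(v, l), u⟩ := fun g => by
    rw [Fintype.sum_sigma, Fintype.sum_prod_type]
  have hC : ∀ l, ∑ v, x v l = C l := by
    intro l₀
    have h1 : ∑ t : T, Sum.elim (fun u => if u.1 = l₀ then 1 else 0) (fun _ => 0) t = C l₀ := by
      simp only [T, Fintype.sum_sum_type, Sum.elim_inl, Sum.elim_inr, Fintype.sum_sigma]
      simp [apply_ite Finset.card]
    rw [← h1, ← hbij.sum_comp, hsumE]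
    refine Finset.sum_congr rfl fun v _ => ?_
    rw [Finset.sum_eq_single l₀]
    · refine Finset.sum_congr rfl fun u _ => ?_
      rcases h : f ⟨(v, l₀), u⟩ with t | t
      · simp [hl _ _ h]
      · simp
    · intro l _ hne
      refine Finset.sum_eq_zero fun u _ => ?_
      rcases h : f ⟨(v, l), u⟩ with t | t
      · simp [hl _ _ h, hne]
      · simp
    · simp
  have hZ : ∀ v, ∑ l, z v l = ∑ l, c v l - R v := by
    intro v₀
    have h1 : ∑ t : T, Sum.elim (fun _ => 0) (fun u => if u.1 = v₀ then 1 else 0) t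
        = ∑ l, c v₀ l - R v₀ := by
      simp only [T, Fintype.sum_sum_type, Sum.elim_inl, Sum.elim_inr, Fintype.sum_sigma]
      simp [apply_ite Finset.card]
    rw [← h1, ← hbij.sum_comp, hsumE, Finset.sum_eq_single v₀]
    · refine Finset.sum_congr rfl fun l _ => Finset.sum_congr rfl fun u _ => ?_
      rcases h : f ⟨(v₀, l), u⟩ with t | t
      · simp
      · simp [hv _ _ h]
    · intro v _ hne
      refine Finset.sum_eq_zero fun l _ => Finset.sum_eq_zero fun u _ => ?_
      rcases h : f ⟨(v, l), u⟩ with t | t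
      · simp
      · simp [hv _ _ h, hne]
    · simp
  refine ⟨x, fun v l => (hxz v l).symm ▸ Nat.le_add_right _ _, fun v => ?_, hC⟩
  have h1 : ∑ l, x v l + ∑ l, z v l = ∑ l, c v l := by
    rw [← Finset.sum_add_distrib]
    exact Finset.sum_congr rfl fun l _ => hxz v l
  have := hZ v
  have := hR v
  omega

/-! ### Equitable splitting and detachment. -/

/-- A matrix all of whose row sums are `m * w v` and column sums `m * d` splits into `m` matrices
with row sums `w v` and column sums `d`. -/
theorem exists_split_of_sum_eq {V L : Type*} [Fintype V] [Fintype L] [DecidableEq V]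
    [DecidableEq L] (w : V → ℕ) (d m : ℕ) (c : V → L → ℕ) (hrow : ∀ v, ∑ l, c v l = m * w v)
    (hcol : ∀ l, ∑ v, c v l = m * d) :
    ∃ p : Fin m → V → L → ℕ, (∀ v l, ∑ t, p t v l = c v l) ∧ (∀ t v, ∑ l, p t v l = w v) ∧
      ∀ t l, ∑ v, p t v l = d := by
  induction m generalizing c with
  | zero =>
    refine ⟨fun _ _ _ => 0, fun v l => ?_, fun t => t.elim0, fun t => t.elim0⟩
    have := hrow v
    simp only [zero_mul, Finset.sum_eq_zero_iff, Finset.mem_univ, true_imp_iff] at this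
    simp [this l]
  | succ m ih =>
    have hm : 0 < m + 1 := m.succ_pos
    have htot : ∑ v, w v = ∑ _l : L, d := by
      refine Nat.eq_of_mul_eq_mul_left m.succ_pos ?_
      rw [Finset.mul_sum, Finset.mul_sum, ← Finset.sum_congr rfl fun v _ => hrow v,
        ← Finset.sum_congr rfl fun l _ => hcol l, Finset.sum_comm]
    -- The matrix c / (m + 1) is a fractional solution, so the cut inequalities hold; they are
    -- checked after multiplication by m + 1.
    obtain ⟨x, hxc, hxr, hxl⟩ := exists_transport w (fun _ => d) c htot (by
      intro I K
      refine le_of_mul_le_mul_left ?_ hm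
      have h1 : ∑ v ∈ I, (m + 1) * w v
          = ∑ v ∈ I, ∑ l ∈ K, c v l + ∑ v ∈ I, ∑ l ∈ Kᶜ, c v l := by
        rw [← Finset.sum_add_distrib]
        exact Finset.sum_congr rfl fun v _ => by rw [Finset.sum_add_sum_compl, hrow]
      have h2 : ∑ v ∈ I, ∑ l ∈ Kᶜ, c v l ≤ ∑ l ∈ Kᶜ, (m + 1) * d := by
        rw [Finset.sum_comm]
        refine Finset.sum_le_sum fun l _ => ?_
        rw [← hcol l]
        exact Finset.sum_le_sum_of_subset (Finset.subset_univ _)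
      rw [mul_add, Finset.mul_sum, Finset.mul_sum, h1]
      have h3 : ∑ v ∈ I, ∑ l ∈ K, c v l ≤ (m + 1) * ∑ v ∈ I, ∑ l ∈ K, c v l :=
        Nat.le_mul_of_pos_left _ hm
      omega)
    obtain ⟨p, hp, hpr, hpl⟩ := ih (fun v l => c v l - x v l)
      (fun v => by
        rw [Finset.sum_tsub_distrib _ fun l _ => hxc v l, hrow, hxr, Nat.succ_mul,
          Nat.add_sub_cancel])
      (fun l => by
        rw [Finset.sum_tsub_distrib _ fun v _ => hxc v l, hcol, hxl, Nat.succ_mul,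
          Nat.add_sub_cancel])
    refine ⟨Fin.cons x p, fun v l => ?_, fun t => ?_, fun t => ?_⟩
    · simp only [Fin.sum_univ_succ, Fin.cons_zero, Fin.cons_succ, hp]
      exact Nat.add_sub_cancel' (hxc v l)
    · refine Fin.cases ?_ (fun t => ?_) t
      · simpa using hxr
      · simpa using hpr t
    · refine Fin.cases ?_ (fun t => ?_) t
      · simpa using hxl
      · simpa using hpl t

/-- A matrix all of whose row sums are `m * w v` and column sums at most `m * d` splits into `m`
matrices with row sums `w v` and column sums at most `d`. -/
theorem exists_split {V L : Type*} [Fintype V] [Fintype L] [DecidableEq V] [DecidableEq L]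
    (w : V → ℕ) (d m : ℕ) (c : V → L → ℕ) (hrow : ∀ v, ∑ l, c v l = m * w v)
    (hcol : ∀ l, ∑ v, c v l ≤ m * d) :
    ∃ p : Fin m → V → L → ℕ, (∀ v l, ∑ t, p t v l = c v l) ∧ (∀ t v, ∑ l, p t v l = w v) ∧
      ∀ t l, ∑ v, p t v l ≤ d := by
  -- An extra row `none` absorbs the column deficits, which reduces the claim to equal column sums.
  obtain ⟨p, hp, hpr, hpl⟩ := exists_split_of_sum_eq
    (fun o : Option V => o.elim (Fintype.card L * d - ∑ v, w v) w) d m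
    (fun o l => o.elim (m * d - ∑ v, c v l) fun v => c v l)
    (by
      rintro (_ | v)
      · simp only [Option.elim_none]
        rw [Finset.sum_tsub_distrib _ fun l _ => hcol l, Finset.sum_comm,
          Finset.sum_congr rfl fun v _ => hrow v, Nat.mul_sub]
        simp only [Finset.sum_const, Finset.card_univ, smul_eq_mul, ← Finset.mul_sum]
        rw [mul_left_comm]
      · exact hrow v)
    (fun l => by
      rw [Fintype.sum_option]
      exact Nat.sub_add_cancel (hcol l))
  refine ⟨fun t v => p t (some v), fun v l => hp (some v) l, fun t v => hpr t (some v),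
    fun t l => ?_⟩
  rw [← hpl t l, Fintype.sum_option]
  exact Nat.le_add_left _ _

/-- Detachment: the right cells `x i`, the bottom cells `y j` and the corner `d` of an array of
symbol counts, with one amalgamated row and one amalgamated column, are split into `p` rows and `q`
columns. -/
theorem exists_detachment {R S L : Type*} [Fintype R] [Fintype S] [Fintype L] [DecidableEq R]
    [DecidableEq S] [DecidableEq L] (p q lam : ℕ) (m : R → S → L → ℕ) (x : R → L → ℕ)
    (y : S → L → ℕ) (d : L → ℕ) (hm : ∀ i j, ∑ l, m i j l = lam)
    (hx : ∀ i, ∑ l, x i l = q * lam) (hy : ∀ j, ∑ l, y j l = p * lam)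
    (hd : ∑ l, d l = q * (p * lam)) (hxd : ∀ l, ∑ i, x i l + d l ≤ q * lam)
    (hyd : ∀ l, ∑ j, y j l + d l ≤ p * lam) (hrow : ∀ i l, ∑ j, m i j l + x i l ≤ lam)
    (hcol : ∀ j l, ∑ i, m i j l + y j l ≤ lam) :
    ∃ F : R ⊕ Fin p → S ⊕ Fin q → L → ℕ, (∀ i j, F (.inl i) (.inl j) = m i j) ∧
      (∀ i j, ∑ l, F i j l = lam) ∧ (∀ i l, ∑ j, F i j l ≤ lam) ∧ (∀ j l, ∑ i, F i j l ≤ lam) ∧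
      ∀ l, ∑ i, ∑ j, F i j l = ∑ i, ∑ j, m i j l + ∑ i, x i l + ∑ j, y j l + d l := by
  -- Split the fat column first, with the corner as an extra row `none` of weight p * lam.
  obtain ⟨X, hX, hXr, hXl⟩ := exists_split (fun o : Option R => o.elim (p * lam) fun _ => lam) lam q
    (fun o => o.elim d x)
    (by
      rintro (_ | i)
      · exact hd
      · exact hx i)
    (fun l => by
      rw [Fintype.sum_option, add_comm]
      exact hxd l)
  have hX0 : ∀ l, ∑ t, X t none l = d l := hX none
  have hX1 : ∀ i l, ∑ t, X t (some i) l = x i l := fun i => hX (some i)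
  -- Then split the fat row, which now meets all columns, old and new. Since the pieces of a cell
  -- add up to it, the column bounds survive.
  obtain ⟨Y, hY, hYr, hYl⟩ := exists_split (fun _ : S ⊕ Fin q => lam) lam p
    (Sum.elim y fun t => X t none)
    (by
      rintro (j | t)
      · exact hy j
      · exact hXr t none)
    (fun l => by
      rw [Fintype.sum_sum_type]
      simp only [Sum.elim_inl, Sum.elim_inr, hX0]
      exact hyd l)
  have hY0 : ∀ j l, ∑ u, Y u (.inl j) l = y j l := fun j => hY (.inl j)
  have hY1 : ∀ t l, ∑ u, Y u (.inr t) l = X t none l := fun t => hY (.inr t)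
  refine ⟨Sum.elim (fun i => Sum.elim (m i) fun t => X t (some i)) Y, fun _ _ => rfl, ?_, ?_, ?_,
    ?_⟩
  · rintro (i | u) j
    · rcases j with j | t
      · exact hm i j
      · exact hXr t (some i)
    · exact hYr u j
  · rintro (i | u) l
    · rw [Fintype.sum_sum_type]
      simpa [hX1] using hrow i l
    · exact hYl u l
  · rintro (j | t) l
    · rw [Fintype.sum_sum_type]
      simpa [hY0] using hcol j l
    · rw [Fintype.sum_sum_type]
      have := hXl t l
      rw [Fintype.sum_option, add_comm] at this
      simpa [hY1] using this
  · intro l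
    rw [Fintype.sum_sum_type, Finset.sum_comm (s := Finset.univ (α := Fin p))]
    simp only [Fintype.sum_sum_type, Sum.elim_inl, Sum.elim_inr, hX1, hY0, hY1, hX0,
      Finset.sum_add_distrib]
    ring

/-! ### Cut conditions with truncated subtraction. -/

namespace RhoLatin

theorem monus_nonneg (x y : ℤ) : 0 ≤ monus x y := le_max_left _ _

theorem sub_le_monus (x y : ℤ) : x - y ≤ monus x y := le_max_right _ _

theorem monus_le {x y z : ℤ} (hz : 0 ≤ z) (h : x - y ≤ z) : monus x y ≤ z := max_le hz h

/-- Cells holding `q * lam` symbols each can be attached to lines in which the symbol `l` occurs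
`g i l` times, so that the symbol `l` is used `A l` times. -/
theorem exists_extend_lines {V L : Type*} [Fintype V] [Fintype L] [DecidableEq V] [DecidableEq L]
    (q lam : ℕ) (g : V → L → ℕ) (A : L → ℕ) (hg : ∀ i l, g i l ≤ lam)
    (hA : ∑ l, A l = Fintype.card V * (q * lam))
    (hcut : ∀ K : Finset L, ∑ i, monus ((q : ℤ) * lam + ∑ l ∈ K, (g i l : ℤ)) (lam * K.card) ≤
      ∑ l ∈ Kᶜ, (A l : ℤ)) :
    ∃ x : V → L → ℕ, (∀ i l, g i l + x i l ≤ lam) ∧ (∀ i, ∑ l, x i l = q * lam) ∧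
      ∀ l, ∑ i, x i l = A l := by
  obtain ⟨x, hxc, hxr, hxl⟩ := exists_transport (fun _ : V => q * lam) A
    (fun i l => lam - g i l) (by simp [hA]) (by
      intro I K
      zify
      have h1 : ∀ i, ∑ l ∈ K, ((lam - g i l : ℕ) : ℤ) = lam * K.card - ∑ l ∈ K, (g i l : ℤ) := by
        intro i
        rw [Finset.sum_congr rfl fun l _ => Nat.cast_sub (hg i l), Finset.sum_sub_distrib]
        simp [mul_comm]
      simp only [h1]
      -- The sum of truncated differences is the largest value over all I of the untruncated sum, so
      -- one inequality per K covers all cuts.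
      have h2 : ∑ i ∈ I, ((q : ℤ) * lam + ∑ l ∈ K, (g i l : ℤ) - lam * K.card) ≤
          ∑ l ∈ Kᶜ, (A l : ℤ) :=
        (Finset.sum_le_sum fun i _ => sub_le_monus _ _).trans
          ((Finset.sum_le_sum_of_subset_of_nonneg (Finset.subset_univ I)
            fun i _ _ => monus_nonneg _ _).trans (hcut K))
      simp only [Finset.sum_sub_distrib, Finset.sum_add_distrib] at h2 ⊢
      linarith)
  exact ⟨x, fun i l => by have := hxc i l; have := hg i l; omega, hxr, hxl⟩

/-- Necessity of the cut condition in `exists_extend_lines`. -/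
theorem sum_monus_le_of_extend_lines {V L : Type*} [Fintype V] [Fintype L] [DecidableEq L]
    (q lam : ℕ) (g x : V → L → ℕ) (hgx : ∀ i l, g i l + x i l ≤ lam)
    (hx : ∀ i, ∑ l, x i l = q * lam) (K : Finset L) :
    ∑ i, monus ((q : ℤ) * lam + ∑ l ∈ K, (g i l : ℤ)) (lam * K.card) ≤
      ∑ l ∈ Kᶜ, ∑ i, (x i l : ℤ) := by
  rw [Finset.sum_comm]
  refine Finset.sum_le_sum fun i _ => monus_le (by positivity) ?_
  have h1 : ∑ l ∈ K, g i l + ∑ l ∈ K, x i l ≤ lam * K.card := by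
    rw [← Finset.sum_add_distrib, mul_comm]
    exact Finset.sum_le_card_nsmul _ _ _ fun l _ => hgx i l
  have h2 := (Finset.sum_add_sum_compl K (x i)).trans (hx i)
  zify at h1 h2
  linarith

/-! ### Counting symbols and indexing blocks. -/

theorem sum_count_eq_card {k : ℕ} (m : Multiset (Fin k)) : ∑ l, m.count l = m.card :=
  Multiset.sum_count_eq_card fun _ _ => Finset.mem_univ _

theorem exists_multiset_count_eq {k : ℕ} (f : Fin k → ℕ) :
    ∃ m : Multiset (Fin k), ∀ l, m.count l = f l :=
  ⟨∑ l, f l • {l}, fun l => by simp [Multiset.count_sum', Multiset.count_singleton]⟩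

theorem sum_occ {r s k lam : ℕ} {M : MultiArray r s k} (hM : IsLambdaMatrix lam M) :
    ∑ l, occ M l = r * (s * lam) := by
  simp only [occ]
  rw [Finset.sum_comm]
  simp only [Finset.sum_comm (s := Finset.univ (α := Fin k)), sum_count_eq_card, hM _ _]
  simp

theorem occ_eq_sum_rowOcc {r s k : ℕ} (M : MultiArray r s k) (l : Fin k) :
    occ M l = ∑ i, rowOcc M i l := rfl

theorem occ_eq_sum_colOcc {r s k : ℕ} (M : MultiArray r s k) (l : Fin k) :
    occ M l = ∑ j, colOcc M j l := Finset.sum_comm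

/-- The decomposition of `Fin n` into its first `r` elements and the remaining ones. -/
def splitEquiv {r p n : ℕ} (h : r + p = n) : Fin r ⊕ Fin p ≃ Fin n :=
  finSumFinEquiv.trans (finCongr h)

theorem splitEquiv_inl {r p n : ℕ} (h : r + p = n) (hr : r ≤ n) (i : Fin r) :
    splitEquiv h (.inl i) = Fin.castLE hr i := by
  ext
  simp [splitEquiv]

/-! ### Sufficiency of admissibility. -/

theorem exists_extension_of_isAdmissible {r s n k lam : ℕ} (hr : r ≤ n) (hs : s ≤ n)
    {rho : Fin k → ℕ} (hrho_sum : ∑ l, rho l = lam * n ^ 2)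
    {M : MultiArray r s k} (hM : IsLatinRectangle rho lam M) (h : IsAdmissible n rho lam M) :
    ∃ N : MultiArray n n k, IsLatinSquare rho lam N ∧ Extends hr hs N M := by
  obtain ⟨a, b, hab⟩ := h
  obtain ⟨p, hp⟩ := Nat.exists_eq_add_of_le hr
  obtain ⟨q, hq⟩ := Nat.exists_eq_add_of_le hs
  have hp' : (n : ℤ) = r + p := by exact_mod_cast hp
  have hq' : (n : ℤ) = s + q := by exact_mod_cast hq
  obtain ⟨A, hA⟩ : ∃ A : Fin k → ℕ, ∀ l,
      (A l : ℤ) = a l + monus ((rho l : ℤ) - occ M l + lam * r) (lam * n) :=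
    ⟨fun l => a l + (monus ((rho l : ℤ) - occ M l + lam * r) (lam * n)).toNat, fun l => by
      rw [Nat.cast_add, Int.toNat_of_nonneg (monus_nonneg _ _)]⟩
  obtain ⟨B, hB⟩ : ∃ B : Fin k → ℕ, ∀ l,
      (B l : ℤ) = b l + monus ((rho l : ℤ) - occ M l + lam * s) (lam * n) :=
    ⟨fun l => b l + (monus ((rho l : ℤ) - occ M l + lam * s) (lam * n)).toNat, fun l => by
      rw [Nat.cast_add, Int.toNat_of_nonneg (monus_nonneg _ _)]⟩
  have hAsum : ∑ l, A l = r * (q * lam) := by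
    have h1 := hab.sum_a
    zify
    simp only [hA, Finset.sum_add_distrib]
    rw [h1, hq']
    ring
  have hBsum : ∑ l, B l = s * (p * lam) := by
    have h1 := hab.sum_b
    zify
    simp only [hB, Finset.sum_add_distrib]
    rw [h1, hp']
    ring
  -- The corner receives what is left of each symbol; `add_le` makes this nonnegative.
  obtain ⟨d, hd⟩ : ∃ d : Fin k → ℕ, ∀ l, occ M l + A l + B l + d l = rho l :=
    ⟨fun l => rho l - (occ M l + A l + B l), fun l => by
      have h1 := hab.add_le l
      have h2 := hA l
      have h3 := hB l
      exact Nat.add_sub_cancel' (by omega)⟩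
  have hdsum : ∑ l, d l = q * (p * lam) := by
    have h1 : ∑ l, (occ M l + A l + B l + d l) = lam * n ^ 2 := by simp only [hd, hrho_sum]
    simp only [Finset.sum_add_distrib, sum_occ hM.isLambdaMatrix, hAsum, hBsum] at h1
    zify at h1 ⊢
    have h2 : (lam : ℤ) * n ^ 2 = lam * ((r + p) * (s + q)) := by
      rw [← hp', ← hq']
      ring
    linarith
  obtain ⟨x, hgx, hx, hxA⟩ := exists_extend_lines q lam (rowOcc M) A hM.rowOcc_le
    (by simpa using hAsum) (fun K => by
      have h1 := hab.row_le K
      simp only [← hA, rowOccSet, Nat.cast_sum] at h1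
      rwa [show (lam : ℤ) * n - lam * s = q * lam by rw [hq']; ring] at h1)
  obtain ⟨y, hgy, hy, hyB⟩ := exists_extend_lines p lam (colOcc M) B hM.colOcc_le
    (by simpa using hBsum) (fun K => by
      have h1 := hab.col_le K
      simp only [← hB, colOccSet, Nat.cast_sum] at h1
      rwa [show (lam : ℤ) * n - lam * r = p * lam by rw [hp']; ring] at h1)
  obtain ⟨F, hFM, hFcell, hFrow, hFcol, hFocc⟩ := exists_detachment p q lam
    (fun i j l => (M i j).count l) x y d
    (fun i j => (sum_count_eq_card _).trans (hM.isLambdaMatrix i j)) hx hy hdsum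
    -- As A + d = ρ - |M_ℓ| - B, the bound qλ for the fat column amounts to B ≥ β; dually, the fat
    -- row uses A ≥ α.
    (fun l => by
      rw [hxA]
      have h1 := hd l
      have h2 := hB l
      have h3 := sub_le_monus ((rho l : ℤ) - occ M l + lam * s) (lam * n)
      have h4 : (lam : ℤ) * n = lam * s + q * lam := by rw [hq']; ring
      zify at h1 ⊢
      linarith [(Nat.cast_nonneg (b l) : (0 : ℤ) ≤ b l)])
    (fun l => by
      rw [hyB]
      have h1 := hd l
      have h2 := hA l
      have h3 := sub_le_monus ((rho l : ℤ) - occ M l + lam * r) (lam * n)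
      have h4 : (lam : ℤ) * n = lam * r + p * lam := by rw [hp']; ring
      zify at h1 ⊢
      linarith [(Nat.cast_nonneg (a l) : (0 : ℤ) ≤ a l)])
    hgx hgy
  let er := splitEquiv hp.symm
  let es := splitEquiv hq.symm
  choose N hN using fun i j => exists_multiset_count_eq (F (er.symm i) (es.symm j))
  refine ⟨N, ⟨fun i j => ?_, fun l => ?_, fun i l => ?_, fun j l => ?_⟩, fun i j => ?_⟩
  · rw [← sum_count_eq_card]
    simp only [hN, hFcell]
  · simp only [occ, hN]
    rw [er.symm.sum_comp fun i => ∑ j, F i (es.symm j) l]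
    simp only [fun i => es.symm.sum_comp fun j => F i j l]
    rw [hFocc, hxA, hyB]
    exact hd l
  · simp only [rowOcc, hN]
    rw [es.symm.sum_comp fun j => F (er.symm i) j l]
    exact hFrow _ l
  · simp only [colOcc, hN]
    rw [er.symm.sum_comp fun i => F i (es.symm j) l]
    exact hFcol _ l
  · ext l
    rw [hN, ← splitEquiv_inl hp.symm hr, ← splitEquiv_inl hq.symm hs, Equiv.symm_apply_apply,
      Equiv.symm_apply_apply, hFM]

/-! ### Necessity of admissibility. -/

theorem isAdmissible_of_extends {r s n k lam : ℕ} (hr : r ≤ n) (hs : s ≤ n)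
    {rho : Fin k → ℕ} {M : MultiArray r s k} {N : MultiArray n n k}
    (hN : IsLatinSquare rho lam N) (hNM : Extends hr hs N M) : IsAdmissible n rho lam M := by
  obtain ⟨p, hp⟩ := Nat.exists_eq_add_of_le hr
  obtain ⟨q, hq⟩ := Nat.exists_eq_add_of_le hs
  have hp' : (n : ℤ) = r + p := by exact_mod_cast hp
  have hq' : (n : ℤ) = s + q := by exact_mod_cast hq
  let er := splitEquiv hp.symm
  let es := splitEquiv hq.symm
  let F : Fin r ⊕ Fin p → Fin s ⊕ Fin q → Fin k → ℕ := fun i j l => (N (er i) (es j)).count l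
  have hFM : ∀ i j l, F (.inl i) (.inl j) l = (M i j).count l := fun i j l => by
    simp only [F, er, es, splitEquiv_inl _ hr, splitEquiv_inl _ hs, hNM i j]
  have hFcell : ∀ i j, ∑ l, F i j l = lam := fun i j =>
    (sum_count_eq_card _).trans (hN.isLambdaMatrix _ _)
  have hFrow : ∀ i l, ∑ j, F i (.inl j) l + ∑ j, F i (.inr j) l ≤ lam := fun i l => by
    rw [← Fintype.sum_sum_type (fun j => F i j l),
      es.sum_comp fun j => (N (er i) j).count l]
    exact hN.rowOcc_le _ l
  have hFcol : ∀ j l, ∑ i, F (.inl i) j l + ∑ i, F (.inr i) j l ≤ lam := fun j l => by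
    rw [← Fintype.sum_sum_type (fun i => F i j l),
      er.sum_comp fun i => (N i (es j)).count l]
    exact hN.colOcc_le _ l
  let x : Fin r → Fin k → ℕ := fun i l => ∑ j, F (.inl i) (.inr j) l
  let y : Fin s → Fin k → ℕ := fun j l => ∑ i, F (.inr i) (.inl j) l
  let A : Fin k → ℕ := fun l => ∑ i, x i l
  let B : Fin k → ℕ := fun l => ∑ j, y j l
  let D : Fin k → ℕ := fun l => ∑ i, ∑ j, F (.inr i) (.inr j) l
  have hgx : ∀ i l, rowOcc M i l + x i l ≤ lam := fun i l => by
    simpa only [rowOcc, hFM] using hFrow (.inl i) l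
  have hgy : ∀ j l, colOcc M j l + y j l ≤ lam := fun j l => by
    simpa only [colOcc, hFM] using hFcol (.inl j) l
  have hx : ∀ i, ∑ l, x i l = q * lam := fun i => by
    simp only [x]
    rw [Finset.sum_comm]
    simp [hFcell]
  have hy : ∀ j, ∑ l, y j l = p * lam := fun j => by
    simp only [y]
    rw [Finset.sum_comm]
    simp [hFcell]
  have hAsum : ∑ l, A l = r * (q * lam) := by
    simp only [A]
    rw [Finset.sum_comm]
    simp [hx]
  have hBsum : ∑ l, B l = s * (p * lam) := by
    simp only [B]
    rw [Finset.sum_comm]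
    simp [hy]
  have hrho : ∀ l, occ M l + A l + B l + D l = rho l := fun l => by
    rw [← hN.occ_eq l, occ.eq_1 N, ← er.sum_comp]
    simp only [fun i => (es.sum_comp fun j => (N i j).count l).symm]
    change _ = ∑ i, ∑ j, F i j l
    simp only [Fintype.sum_sum_type, hFM, Finset.sum_add_distrib]
    rw [Finset.sum_comm (s := Finset.univ (α := Fin p)) (t := Finset.univ (α := Fin s))]
    simp only [occ, A, B, D, x, y]
    ring
  have hMA : ∀ l, occ M l + A l ≤ r * lam := fun l => by
    simp only [occ_eq_sum_rowOcc, A, ← Finset.sum_add_distrib]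
    simpa using Finset.sum_le_card_nsmul Finset.univ _ _ fun i _ => hgx i l
  have hMB : ∀ l, occ M l + B l ≤ s * lam := fun l => by
    simp only [occ_eq_sum_colOcc, B, ← Finset.sum_add_distrib]
    simpa using Finset.sum_le_card_nsmul Finset.univ _ _ fun j _ => hgy j l
  have hAD : ∀ l, A l + D l ≤ q * lam := fun l => by
    simp only [A, D, x]
    rw [Finset.sum_comm, Finset.sum_comm (s := Finset.univ (α := Fin p)),
      ← Finset.sum_add_distrib]
    simpa using Finset.sum_le_card_nsmul Finset.univ _ _ fun j _ => hFcol (.inr j) l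
  have hBD : ∀ l, B l + D l ≤ p * lam := fun l => by
    simp only [B, D, y]
    rw [Finset.sum_comm, ← Finset.sum_add_distrib]
    simpa using Finset.sum_le_card_nsmul Finset.univ _ _ fun i _ => hFrow (.inr i) l
  -- The bound comes from the last p rows: ρ - |M_ℓ| - A = B + D ≤ pλ.
  have hα : ∀ l, monus ((rho l : ℤ) - occ M l + lam * r) (lam * n) ≤ A l := fun l => by
    refine monus_le (by positivity) ?_
    have h1 := hrho l
    have h2 := hBD l
    zify at h1 h2
    rw [hp']
    linarith
  have hβ : ∀ l, monus ((rho l : ℤ) - occ M l + lam * s) (lam * n) ≤ B l := fun l => by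
    refine monus_le (by positivity) ?_
    have h1 := hrho l
    have h2 := hAD l
    zify at h1 h2
    rw [hq']
    linarith
  obtain ⟨a, ha⟩ : ∃ a : Fin k → ℕ, ∀ l,
      (a l : ℤ) = A l - monus ((rho l : ℤ) - occ M l + lam * r) (lam * n) :=
    ⟨fun l => (A l - monus ((rho l : ℤ) - occ M l + lam * r) (lam * n)).toNat, fun l =>
      Int.toNat_of_nonneg (sub_nonneg.2 (hα l))⟩
  obtain ⟨b, hb⟩ : ∃ b : Fin k → ℕ, ∀ l,
      (b l : ℤ) = B l - monus ((rho l : ℤ) - occ M l + lam * s) (lam * n) :=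
    ⟨fun l => (B l - monus ((rho l : ℤ) - occ M l + lam * s) (lam * n)).toNat, fun l =>
      Int.toNat_of_nonneg (sub_nonneg.2 (hβ l))⟩
  refine ⟨a, b, ?_, ?_, fun l => ?_, fun l => ?_, fun l => ?_, fun K => ?_, fun K => ?_⟩
  · zify at hAsum
    simp only [ha, Finset.sum_sub_distrib, hAsum]
    rw [hq']
    ring
  · zify at hBsum
    simp only [hb, Finset.sum_sub_distrib, hBsum]
    rw [hp']
    ring
  · have h1 := hMA l
    zify at h1
    rw [ha]
    linarith
  · have h1 := hMB l
    zify at h1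
    rw [hb]
    linarith
  · have h1 := hrho l
    zify at h1
    rw [ha, hb]
    linarith [(Nat.cast_nonneg (D l) : (0 : ℤ) ≤ D l)]
  · have h1 := sum_monus_le_of_extend_lines q lam (rowOcc M) x hgx hx K
    simp only [ha, sub_add_cancel, rowOccSet, Nat.cast_sum, A]
    rwa [show (lam : ℤ) * n - lam * s = q * lam by rw [hq']; ring]
  · have h1 := sum_monus_le_of_extend_lines p lam (colOcc M) y hgy hy K
    simp only [hb, sub_add_cancel, colOccSet, Nat.cast_sum, B]
    rwa [show (lam : ℤ) * n - lam * r = p * lam by rw [hp']; ring]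

end RhoLatin

theorem mainTheorem2 (r s n k lam : ℕ) (hn : 1 ≤ n) (hlam : 1 ≤ lam)
    (hr : r ≤ n) (hs : s ≤ n) (hnk : n ≤ k)
    (rho : Fin k → ℕ) (hrho_pos : ∀ l, 1 ≤ rho l) (hrho_le : ∀ l, rho l ≤ lam * n)
    (hrho_sum : ∑ l, rho l = lam * n ^ 2)
    (M : RhoLatin.MultiArray r s k) (hM : RhoLatin.IsLatinRectangle rho lam M) :
    (∃ N : RhoLatin.MultiArray n n k,
        RhoLatin.IsLatinSquare rho lam N ∧ RhoLatin.Extends hr hs N M) ↔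
      RhoLatin.IsAdmissible n rho lam M :=
  ⟨fun ⟨_, hN, hNM⟩ => RhoLatin.isAdmissible_of_extends hr hs hN hNM,
    RhoLatin.exists_extension_of_isAdmissible hr hs hrho_sum hM⟩
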